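/- Let $\mathcal H$ be a complex Hilbert space with scalar product $\langle\cdot,\cdot\rangle$ linear in the second argument. Let $\mathcal F_+(\mathcal H)$ be the bosonic Fock space, i.e. the Hilbert space of symmetric tensors in the full Fock space $\widehat\bigoplus_{n\ge 0}\mathcal H^{\hat\otimes n}$. For $v\in\mathcal H$ put $$\mathrm{Exp}(v)=\sum_{n\ge 0}\tfrac1{n!}\,v^{\vee n},\qquad v_1\vee\cdots\vee v_n=\tfrac1{\sqrt{n!}}\sum_{\sigma\in S_n}v_{\sigma(1)}\otimes\cdots\otimes v_{\sigma(n)},$$ and let $\Omega=\mathrm{Exp}(0)$ be the vacuum vector. For $x\in\mathcal H$ let $U_x$ be the unitary operator on $\mathcal F_+(\mathcal H)$ determined by $$U_x\,\mathrm{Exp}(v)=e^{-\langle x,v\rangle-\|x\|^2/2}\,\mathrm{Exp}(v+x)\qquad(v\in\mathcal H),$$ and let $W(v)=U_{iv/\sqrt2}$ be the Weyl operators. The Heisenberg group $\mathrm{Heis}(\mathcal H)=\mathbb T\times\mathcal H$, with product $(z,v)(z',v')=(zz'e^{-i\,\mathrm{Im}\langle v,v'\rangle},v+v')$, is represented unitarily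 on $\mathcal F_+(\mathcal H)$ by $(z,v)\mapsto zU_v$. For a real linear subspace $V\subseteq\mathcal H$ (not necessarily closed) let $\mathcal R(V)=W(V)''\subseteq B(\mathcal F_+(\mathcal H))$ be the bicommutant of $\{W(v):v\in V\}$, a von Neumann algebra, and let $V'=\{w\in\mathcal H:\mathrm{Im}\langle v,w\rangle=0\text{ for all }v\in V\}$. A closed real subspace $V$ is called standard if $V\cap iV=\{0\}$ and $V+iV$ is dense in $\mathcal H$. A unit vector $\xi$ is cyclic for a von Neumann algebra $\mathcal M$ if $\mathcal M\xi$ is dense, and separating if $M\mapsto M\xi$ is injective on $\mathcal M$. For all real linear subspaces $V,W\subseteq\mathcal H$ the following hold. 1. $\mathcal R(\mathcal H)=B(\mathcal F_+(\mathcal H))$, and the representation of $\mathrm{Heis}(\mathcal H)$ on $\mathcal F_+(\mathcal H)$ is irreducible. 2. $\mathcal R(V)\subseteq\mathcal R(W)'$ if and only if $V\subseteq W'$. 3. $\mathcal R(V)=\mathcal R(\overline V)$. 4. $\Omega$ is cyclic for $\mathcal R(V)$ if and only if $V+iV$ is dense in $\mathcal H$. 5. $\Omega$ is separating for $\mathcal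 R(V)$ if and only if $\overline V\cap i\overline V=\{0\}$. 6. $\Omega$ is cyclic and separating for $\mathcal R(V)$ if and only if $\overline V$ is standard. -/

import Mathlib

open scoped TensorProduct InnerProductSpace

noncomputable section

namespace BoseFock

universe u

/-- The algebraic `n`-fold tensor power of `H` over `ℂ`, as a type of its own
(it carries the Hilbert space scalar product below, not the injective seminorm). -/
def AlgTensor (H : Type u) [NormedAddCommGroup H] [InnerProductSpace ℂ H] (n : ℕ) : Type u :=
  ⨂[ℂ] _ : Fin n, H

variable {H : Type u} [NormedAddCommGroup H] [InnerProductSpace ℂ H]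

instance (n : ℕ) : AddCommGroup (AlgTensor H n) :=
  inferInstanceAs (AddCommGroup (⨂[ℂ] _ : Fin n, H))

instance (n : ℕ) : Module ℂ (AlgTensor H n) :=
  inferInstanceAs (Module ℂ (⨂[ℂ] _ : Fin n, H))

/-- The elementary tensor `v 0 ⊗ ⋯ ⊗ v (n-1)`. -/
def tprod {n : ℕ} : MultilinearMap ℂ (fun _ : Fin n => H) (AlgTensor H n) :=
  PiTensorProduct.tprod ℂ

/-- Linear maps out of the algebraic tensor power. -/
def tlift {n : ℕ} {E : Type*} [AddCommGroup E] [Module ℂ E]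
    (φ : MultilinearMap ℂ (fun _ : Fin n => H) E) : AlgTensor H n →ₗ[ℂ] E :=
  PiTensorProduct.lift φ

theorem tlift_tprod {n : ℕ} {E : Type*} [AddCommGroup E] [Module ℂ E]
    (φ : MultilinearMap ℂ (fun _ : Fin n => H) E) (v : Fin n → H) :
    tlift φ (tprod v) = φ v :=
  PiTensorProduct.lift.tprod v

theorem span_tprod (n : ℕ) :
    Submodule.span ℂ (Set.range (tprod : (Fin n → H) → AlgTensor H n)) = ⊤ :=
  PiTensorProduct.span_tprod_eq_top

theorem alg_induction {n : ℕ} {p : AlgTensor H n → Prop} (x : AlgTensor H n)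
    (h0 : p 0) (h1 : ∀ v, p (tprod v)) (h2 : ∀ x y, p x → p y → p (x + y))
    (h3 : ∀ (c : ℂ) x, p x → p (c • x)) : p x := by
  have hx : x ∈ Submodule.span ℂ (Set.range (tprod : (Fin n → H) → AlgTensor H n)) := by
    rw [span_tprod]; trivial
  induction hx using Submodule.span_induction with
  | mem x h => obtain ⟨v, rfl⟩ := h; exact h1 v
  | zero => exact h0
  | add x y _ _ hx hy => exact h2 x y hx hy
  | smul c x _ hx => exact h3 c x hx

theorem alg_hom_ext {n : ℕ} {E : Type*} [AddCommGroup E] [Module ℂ E]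
    {f g : AlgTensor H n →ₗ[ℂ] E} (h : ∀ v, f (tprod v) = g (tprod v)) : f = g := by
  ext x
  induction x using alg_induction with
  | h0 => simp
  | h1 v => exact h v
  | h2 x y hx hy => simp [hx, hy]
  | h3 c x hx => simp [hx]

/-- `w ↦ ∏ i, ⟪v i, w i⟫` as a multilinear map. -/
def prodInner {n : ℕ} (v : Fin n → H) : MultilinearMap ℂ (fun _ : Fin n => H) ℂ :=
  (MultilinearMap.mkPiAlgebra ℂ (Fin n) ℂ).compLinearMap fun i => innerₛₗ ℂ (v i)

theorem prodInner_apply {n : ℕ} (v w : Fin n → H) : prodInner v w = ∏ i, ⟪v i, w i⟫_ℂ := by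
  simp [prodInner]

/-- The functional `⟪w, ·⟫` on the tensor power, for an elementary tensor `w`. -/
def conjFunctional {n : ℕ} (w : Fin n → H) : AlgTensor H n →ₗ⋆[ℂ] ℂ :=
  (starLinearEquiv ℂ (A := ℂ)).toLinearMap.comp (tlift (prodInner w))

theorem conjFunctional_tprod {n : ℕ} (w v : Fin n → H) :
    conjFunctional w (tprod v) = ∏ i, ⟪v i, w i⟫_ℂ := by
  simp [conjFunctional, tlift_tprod, prodInner_apply]

theorem semi_hom_ext {n : ℕ} 
    {f g : AlgTensor H n →ₗ⋆[ℂ] ℂ} (h : ∀ v, f (tprod v) = g (tprod v)) : f = g := by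
  ext x
  induction x using alg_induction with
  | h0 => simp
  | h1 v => exact h v
  | h2 x y hx hy => simp [hx, hy]
  | h3 c x hx => simp [hx]

/-- The scalar product of the tensor power, as a map linear in its (second) argument `y`
with values in the antilinear functionals of the first argument. -/
def sesq (H : Type u) [NormedAddCommGroup H] [InnerProductSpace ℂ H] (n : ℕ) :
    AlgTensor H n →ₗ[ℂ] (AlgTensor H n →ₗ⋆[ℂ] ℂ) :=
  tlift
    { toFun := fun w => conjFunctional w
      map_update_add' := by
        intro _ w i x y
        refine semi_hom_ext fun v => ?_
        rw [LinearMap.add_apply]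
        simp only [conjFunctional_tprod, ← prodInner_apply, MultilinearMap.map_update_add]
      map_update_smul' := by
        intro _ w i c x
        refine semi_hom_ext fun v => ?_
        rw [LinearMap.smul_apply]
        simp only [conjFunctional_tprod, ← prodInner_apply, MultilinearMap.map_update_smul] }

theorem sesq_tprod {n : ℕ} (v w : Fin n → H) :
    sesq H n (tprod w) (tprod v) = ∏ i, ⟪v i, w i⟫_ℂ := by
  rw [sesq, tlift_tprod]
  exact conjFunctional_tprod w v

theorem alg_conj_symm {n : ℕ} (x y : AlgTensor H n) :
    (starRingEnd ℂ) (sesq H n x y) = sesq H n y x := by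
  induction x using alg_induction with
  | h0 => simp
  | h2 x y hx hy => simp [hx, hy]
  | h3 c x hx => simp [hx]
  | h1 v =>
    induction y using alg_induction with
    | h0 => simp
    | h2 x y hx hy => simp [hx, hy]
    | h3 c x hx => simp [hx]
    | h1 w =>
      rw [sesq_tprod, sesq_tprod, map_prod]
      simp

/-- `A ⊗ ⋯ ⊗ A` on the algebraic tensor power. -/
def algMap {K : Type u} [NormedAddCommGroup K] [InnerProductSpace ℂ K] (n : ℕ) (f : K →ₗ[ℂ] H) :
    AlgTensor K n →ₗ[ℂ] AlgTensor H n :=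
  tlift ((tprod (n := n)).compLinearMap fun _ => f)

theorem algMap_tprod {K : Type u} [NormedAddCommGroup K] [InnerProductSpace ℂ K] {n : ℕ}
    (f : K →ₗ[ℂ] H) (v : Fin n → K) : algMap n f (tprod v) = tprod fun i => f (v i) := by
  rw [algMap, tlift_tprod]; rfl

theorem sesq_algMap {n : ℕ} (S : Submodule ℂ H) (x y : AlgTensor S n) :
    sesq H n (algMap n S.subtype y) (algMap n S.subtype x) = sesq S n y x := by
  induction x using alg_induction with
  | h0 => simp
  | h2 x y hx hy => simp [hx, hy]
  | h3 c x hx => simp [hx]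
  | h1 v =>
    induction y using alg_induction with
    | h0 => simp
    | h2 x y hx hy => simp [hx, hy]
    | h3 c x hx => simp [hx]
    | h1 w =>
      simp only [algMap_tprod, sesq_tprod]
      simp

theorem exists_finite {n : ℕ} (x : AlgTensor H n) :
    ∃ S : Submodule ℂ H, FiniteDimensional ℂ S ∧ x ∈ LinearMap.range (algMap n S.subtype) := by
  have mono : ∀ S T : Submodule ℂ H, S ≤ T →
      LinearMap.range (algMap n S.subtype) ≤ LinearMap.range (algMap n T.subtype) := by
    rintro S T h _ ⟨y, rfl⟩
    refine ⟨algMap n (Submodule.inclusion h) y, ?_⟩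
    rw [← LinearMap.comp_apply]
    congr 1
    refine alg_hom_ext fun v => ?_
    simp [algMap_tprod]
  induction x using alg_induction with
  | h0 => exact ⟨⊥, inferInstance, zero_mem _⟩
  | h1 v =>
    refine ⟨Submodule.span ℂ (Set.range v),
      FiniteDimensional.span_of_finite ℂ (Set.finite_range v),
      ⟨tprod fun i => ⟨v i, Submodule.subset_span ⟨i, rfl⟩⟩, ?_⟩⟩
    simp [algMap_tprod]
  | h2 x y hx hy =>
    obtain ⟨S, hS, hx⟩ := hx
    obtain ⟨T, hT, hy⟩ := hy
    exact ⟨S ⊔ T, inferInstance,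
      add_mem (mono _ _ le_sup_left hx) (mono _ _ le_sup_right hy)⟩
  | h3 c x hx =>
    obtain ⟨S, hS, hx⟩ := hx
    exact ⟨S, hS, Submodule.smul_mem _ _ hx⟩

theorem alg_inner_self {n : ℕ} (x : AlgTensor H n) :
    0 ≤ RCLike.re (sesq H n x x) ∧ (sesq H n x x = 0 → x = 0) := by
  classical
  obtain ⟨S, hS, y, rfl⟩ := exists_finite x
  rw [sesq_algMap]
  let e := stdOrthonormalBasis ℂ S
  let b : Module.Basis (Fin n → Fin (Module.finrank ℂ S)) ℂ (AlgTensor S n) :=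
    Basis.piTensorProduct fun _ => e.toBasis
  have hb : ∀ p, b p = tprod fun i => e (p i) := fun p => by
    simp only [b]
    erw [Basis.piTensorProduct_apply]
    simp only [OrthonormalBasis.coe_toBasis]
    rfl
  have key : sesq S n y y = ((∑ p, ‖b.repr y p‖ ^ 2 : ℝ) : ℂ) := by
    have hbb : ∀ p q, sesq S n (b p) (b q) = if p = q then 1 else 0 := by
      intro p q
      rw [hb, hb, sesq_tprod]
      simp only [OrthonormalBasis.inner_eq_ite, Fintype.prod_ite_zero]
      simp [funext_iff, eq_comm]
    conv_lhs => rw [← b.sum_repr y]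
    simp only [map_sum, LinearMap.sum_apply, map_smul, LinearMap.smul_apply, hbb,
      LinearMap.map_smulₛₗ]
    simp [RCLike.conj_mul]
  rw [key]
  constructor
  · rw [RCLike.re_to_complex, Complex.ofReal_re]
    exact Finset.sum_nonneg fun p _ => sq_nonneg _
  · intro h
    have h' : ∑ p, ‖b.repr y p‖ ^ 2 = 0 := by exact_mod_cast h
    rw [Finset.sum_eq_zero_iff_of_nonneg fun _ _ => sq_nonneg _] at h'
    have : y = 0 := b.ext_elem fun p => by simpa using h' p (Finset.mem_univ _)
    rw [this, map_zero]

/-- The scalar product axioms on the algebraic tensor power. -/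
@[reducible]
def algCore (H : Type u) [NormedAddCommGroup H] [InnerProductSpace ℂ H] (n : ℕ) :
    InnerProductSpace.Core ℂ (AlgTensor H n) where
  inner := fun x y => sesq H n y x
  conj_inner_symm := alg_conj_symm
  re_inner_nonneg x := (alg_inner_self x).1
  definite x := (alg_inner_self x).2
  add_left x y z := by simp
  smul_left x y c := by simp

instance (n : ℕ) : NormedAddCommGroup (AlgTensor H n) :=
  (algCore H n).toNormedAddCommGroup

instance (n : ℕ) : InnerProductSpace ℂ (AlgTensor H n) :=
  InnerProductSpace.ofCore (algCore H n).toCore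

theorem inner_tprod {n : ℕ} (v w : Fin n → H) :
    ⟪(tprod v : AlgTensor H n), tprod w⟫_ℂ = ∏ i, ⟪v i, w i⟫_ℂ :=
  sesq_tprod v w

/-! ### Full and bosonic Fock space -/

/-- The Hilbert space tensor power `H ⊗̂ ⋯ ⊗̂ H` (`n` factors). -/
abbrev TensorPow (H : Type u) [NormedAddCommGroup H] [InnerProductSpace ℂ H] (n : ℕ) : Type u :=
  UniformSpace.Completion (AlgTensor H n)

/-- The elementary tensor `v 0 ⊗ ⋯ ⊗ v (n-1)` in the Hilbert space tensor power. -/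
def tmul {n : ℕ} (v : Fin n → H) : TensorPow H n := ((tprod v : AlgTensor H n) : TensorPow H n)

theorem inner_tmul {n : ℕ} (v w : Fin n → H) : ⟪tmul v, tmul w⟫_ℂ = ∏ i, ⟪v i, w i⟫_ℂ := by
  rw [tmul, tmul, UniformSpace.Completion.inner_coe, inner_tprod]

/-- The permutation action on the algebraic tensor power:
`v 0 ⊗ ⋯ ⊗ v (n-1) ↦ v (σ⁻¹ 0) ⊗ ⋯ ⊗ v (σ⁻¹ (n-1))`. -/
def algPerm {n : ℕ} (σ : Equiv.Perm (Fin n)) : AlgTensor H n →ₗ[ℂ] AlgTensor H n :=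
  (PiTensorProduct.reindex ℂ (fun _ : Fin n => H) σ).toLinearMap

theorem algPerm_tprod {n : ℕ} (σ : Equiv.Perm (Fin n)) (v : Fin n → H) :
    algPerm σ (tprod v) = tprod fun i => v (σ.symm i) :=
  PiTensorProduct.reindex_tprod (R := ℂ) σ v

theorem inner_algPerm {n : ℕ} (σ : Equiv.Perm (Fin n)) (x y : AlgTensor H n) :
    ⟪algPerm σ x, algPerm σ y⟫_ℂ = ⟪x, y⟫_ℂ := by
  induction x using alg_induction with
  | h0 => simp
  | h2 x y hx hy => simp [hx, hy]
  | h3 c x hx => simp [hx]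
  | h1 v =>
    induction y using alg_induction with
    | h0 => simp
    | h2 x y hx hy => simp [hx, hy]
    | h3 c x hx => simp [hx]
    | h1 w =>
      rw [algPerm_tprod, algPerm_tprod, inner_tprod, inner_tprod]
      exact Equiv.prod_comp σ.symm fun i => ⟪v i, w i⟫_ℂ

/-- The permutation action on the Hilbert space tensor power, by continuous extension. -/
def permOp {n : ℕ} (σ : Equiv.Perm (Fin n)) : TensorPow H n →L[ℂ] TensorPow H n :=
  LinearMap.extendOfNorm
    ((UniformSpace.Completion.toComplₗᵢ (𝕜 := ℂ) (E := AlgTensor H n)).toLinearMap ∘ₗ algPerm σ)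
    (UniformSpace.Completion.toComplₗᵢ (𝕜 := ℂ) (E := AlgTensor H n)).toLinearMap

theorem permOp_coe {n : ℕ} (σ : Equiv.Perm (Fin n)) (x : AlgTensor H n) :
    permOp σ (x : TensorPow H n) = (algPerm σ x : AlgTensor H n) := by
  refine LinearMap.extendOfNorm_eq
    (e := (UniformSpace.Completion.toComplₗᵢ (𝕜 := ℂ) (E := AlgTensor H n)).toLinearMap)
    (UniformSpace.Completion.denseRange_coe) ⟨1, fun x => ?_⟩ x
  have h : ‖algPerm σ x‖ = ‖x‖ := by
    rw [@norm_eq_sqrt_re_inner ℂ, @norm_eq_sqrt_re_inner ℂ, inner_algPerm]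
  simp [h]

theorem permOp_tmul {n : ℕ} (σ : Equiv.Perm (Fin n)) (v : Fin n → H) :
    permOp σ (tmul v) = tmul fun i => v (σ.symm i) := by
  rw [tmul, permOp_coe, algPerm_tprod, tmul]

/-- The full Fock space: the Hilbert space direct sum of the tensor powers. -/
abbrev FullFock (H : Type u) [NormedAddCommGroup H] [InnerProductSpace ℂ H] : Type u :=
  lp (fun n : ℕ => TensorPow H n) 2

/-- The symmetric tensors in the full Fock space. -/
def symTensors (H : Type u) [NormedAddCommGroup H] [InnerProductSpace ℂ H] :
    Submodule ℂ (FullFock H) where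
  carrier := {ξ | ∀ (n : ℕ) (σ : Equiv.Perm (Fin n)), permOp σ (ξ n) = ξ n}
  add_mem' := by
    intro ξ η hξ hη n σ
    rw [lp.coeFn_add, Pi.add_apply, map_add, hξ n σ, hη n σ]
  zero_mem' := by
    intro n σ
    rw [lp.coeFn_zero, Pi.zero_apply, map_zero]
  smul_mem' := by
    intro c ξ hξ n σ
    rw [lp.coeFn_smul, Pi.smul_apply, map_smul, hξ n σ]

theorem mem_symTensors {ξ : FullFock H} :
    ξ ∈ symTensors H ↔ ∀ (n : ℕ) (σ : Equiv.Perm (Fin n)), permOp σ (ξ n) = ξ n := Iff.rfl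

theorem isClosed_symTensors : IsClosed (symTensors H : Set (FullFock H)) := by
  have : (symTensors H : Set (FullFock H)) =
      ⋂ (n : ℕ) (σ : Equiv.Perm (Fin n)), {ξ | permOp σ (ξ n) = ξ n} := by
    ext ξ; simp [mem_symTensors]
  rw [this]
  refine isClosed_iInter fun n => isClosed_iInter fun σ => ?_
  have hc : Continuous fun ξ : FullFock H => ξ n :=
    (lp.evalCLM ℂ (fun n : ℕ => TensorPow H n) 2 n).continuous
  exact isClosed_eq ((permOp σ).continuous.comp hc) hc

/-- The bosonic Fock space: the symmetric tensors, as a Hilbert space of its own. -/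
def BosonicFock (H : Type u) [NormedAddCommGroup H] [InnerProductSpace ℂ H] : Type u :=
  symTensors H

instance : NormedAddCommGroup (BosonicFock H) :=
  inferInstanceAs (NormedAddCommGroup (symTensors H))

instance : InnerProductSpace ℂ (BosonicFock H) :=
  inferInstanceAs (InnerProductSpace ℂ (symTensors H))

instance : CompleteSpace (BosonicFock H) :=
  isClosed_symTensors.completeSpace_coe

/-- The isometric inclusion of the bosonic into the full Fock space. -/
def incl (H : Type u) [NormedAddCommGroup H] [InnerProductSpace ℂ H] :
    BosonicFock H →ₗᵢ[ℂ] FullFock H :=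
  (symTensors H).subtypeₗᵢ

theorem incl_mem (ξ : BosonicFock H) : incl H ξ ∈ symTensors H := ξ.2

/-- `v 0 ∨ ⋯ ∨ v (n-1)`, the symmetrised product with the normalisation `1 / √(n!)`. -/
def vee {n : ℕ} (v : Fin n → H) : TensorPow H n :=
  ((√(n.factorial : ℝ))⁻¹ : ℂ) • ∑ σ : Equiv.Perm (Fin n), tmul fun i => v (σ i)

theorem vee_const (n : ℕ) (v : H) :
    ((n.factorial : ℂ)⁻¹) • vee (fun _ : Fin n => v) =
      ((√(n.factorial : ℝ))⁻¹ : ℂ) • tmul fun _ : Fin n => v := by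
  have h : (n.factorial : ℂ) ≠ 0 := by exact_mod_cast n.factorial_ne_zero
  rw [vee, Finset.sum_const, Finset.card_univ, Fintype.card_perm, Fintype.card_fin,
    ← Nat.cast_smul_eq_nsmul ℂ, smul_smul, smul_smul]
  congr 1
  field_simp

theorem inner_expComp (n : ℕ) (v w : H) :
    ⟪((n.factorial : ℂ)⁻¹) • vee (fun _ : Fin n => v),
      ((n.factorial : ℂ)⁻¹) • vee (fun _ : Fin n => w)⟫_ℂ = ⟪v, w⟫_ℂ ^ n / n.factorial := by
  rw [vee_const, vee_const, inner_smul_left, inner_smul_right, inner_tmul, Finset.prod_const,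
    Finset.card_univ, Fintype.card_fin, ← mul_assoc, map_inv₀, Complex.conj_ofReal, ← mul_inv,
    ← Complex.ofReal_mul, Real.mul_self_sqrt (Nat.cast_nonneg _), Complex.ofReal_natCast,
    div_eq_inv_mul]

theorem norm_expComp_sq (n : ℕ) (v : H) :
    ‖((n.factorial : ℂ)⁻¹) • vee (fun _ : Fin n => v)‖ ^ 2 = (‖v‖ ^ 2) ^ n / n.factorial := by
  have h := inner_expComp n v v
  rw [inner_self_eq_norm_sq_to_K, inner_self_eq_norm_sq_to_K] at h
  apply Complex.ofReal_injective
  push_cast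
  exact h

theorem permOp_vee_const {n : ℕ} (σ : Equiv.Perm (Fin n)) (v : H) :
    permOp σ (((n.factorial : ℂ)⁻¹) • vee (fun _ : Fin n => v)) =
      ((n.factorial : ℂ)⁻¹) • vee (fun _ : Fin n => v) := by
  rw [vee_const, map_smul, permOp_tmul]

/-- The exponential vector `∑ n, (1 / n!) vⁿ` with `vⁿ = v ∨ ⋯ ∨ v`. -/
def expVec (v : H) : BosonicFock H :=
  ⟨⟨fun n => ((n.factorial : ℂ)⁻¹) • vee (fun _ : Fin n => v), by
    refine memℓp_gen ?_
    simp only [ENNReal.toReal_ofNat, Real.rpow_two, norm_expComp_sq]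
    exact Real.summable_pow_div_factorial _⟩, fun _ σ => permOp_vee_const σ v⟩

theorem expVec_apply (v : H) (n : ℕ) :
    incl H (expVec v) n = ((n.factorial : ℂ)⁻¹) • vee (fun _ : Fin n => v) := rfl

theorem inner_expVec (v w : H) : ⟪expVec v, expVec w⟫_ℂ = Complex.exp ⟪v, w⟫_ℂ := by
  rw [← (incl H).inner_map_map, lp.inner_eq_tsum]
  simp only [expVec_apply, inner_expComp]
  rw [Complex.exp_eq_exp_ℂ, NormedSpace.exp_eq_tsum_div]

theorem inner_permOp {n : ℕ} (σ : Equiv.Perm (Fin n)) (x y : TensorPow H n) :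
    ⟪permOp σ x, permOp σ y⟫_ℂ = ⟪x, y⟫_ℂ := by
  induction x, y using UniformSpace.Completion.induction_on₂ with
  | hp => exact isClosed_eq (by fun_prop) (by fun_prop)
  | ih x y => simp only [permOp_coe, UniformSpace.Completion.inner_coe, inner_algPerm]

/-- A symmetric multilinear form which vanishes on the diagonal is zero. -/
theorem multilinear_eq_zero {n : ℕ} (g : MultilinearMap ℂ (fun _ : Fin n => H) ℂ)
    (hs : ∀ (σ : Equiv.Perm (Fin n)) v, g (fun i => v (σ i)) = g v)
    (hd : ∀ v : H, g (fun _ => v) = 0) (v : Fin n → H) : g v = 0 := by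
  classical
  let p : MvPolynomial (Fin n) ℂ := ∑ f : Fin n → Fin n,
    MvPolynomial.monomial (∑ k, Finsupp.single (f k) 1) (g fun k => v (f k))
  have hp : p = 0 := by
    refine MvPolynomial.funext fun t => ?_
    have h := hd (∑ i, t i • v i)
    rw [MultilinearMap.map_sum] at h
    simp only [MultilinearMap.map_smul_univ] at h
    rw [map_zero, ← h, map_sum]
    refine Finset.sum_congr rfl fun f _ => ?_
    rw [MvPolynomial.eval_monomial, smul_eq_mul, mul_comm]
    congr 1
    rw [← Finsupp.prod_finsetSum_index (by simp) (by intros; rw [pow_add])]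
    simp
  have hc := congrArg (MvPolynomial.coeff (∑ k, Finsupp.single k 1)) hp
  simp only [p, MvPolynomial.coeff_sum, MvPolynomial.coeff_monomial, MvPolynomial.coeff_zero] at hc
  rw [← Finset.sum_filter, Finset.sum_congr rfl (g := fun _ => g v), Finset.sum_const,
    smul_eq_zero] at hc
  · refine hc.resolve_left ?_
    refine (Finset.card_pos.mpr ⟨id, ?_⟩).ne'
    simp
  · intro f hf
    have hf' := (Finset.mem_filter.mp hf).2
    have hsurj : Function.Surjective f := by
      intro i
      by_contra hi
      push Not at hi
      have := DFunLike.congr_fun hf' i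
      simp only [Finsupp.coe_finsetSum, Finset.sum_apply, Finsupp.single_apply, hi] at this
      simp at this
    exact hs (Equiv.ofBijective f ⟨Finite.injective_iff_surjective.mpr hsurj, hsurj⟩) v

theorem eq_zero_of_inner_tmul {n : ℕ} {x : TensorPow H n} (h : ∀ v : Fin n → H, ⟪x, tmul v⟫_ℂ = 0) :
    x = 0 := by
  rw [← inner_self_eq_zero (𝕜 := ℂ)]
  have key : ∀ y : TensorPow H n, ⟪x, y⟫_ℂ = 0 := by
    intro y
    induction y using UniformSpace.Completion.induction_on with
    | hp => exact isClosed_eq (by fun_prop) (by fun_prop)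
    | ih y =>
      induction y using alg_induction with
      | h0 => rw [UniformSpace.Completion.coe_zero, inner_zero_right]
      | h1 v => exact h v
      | h2 a b ha hb => rw [UniformSpace.Completion.coe_add, inner_add_right, ha, hb, add_zero]
      | h3 c a ha => rw [UniformSpace.Completion.coe_smul, inner_smul_right, ha, mul_zero]
  exact key x

theorem eq_zero_of_power_series {a : ℕ → ℂ} (h : ∀ t : ℂ, HasSum (fun n => t ^ n * a n) 0) (n : ℕ) :
    a n = 0 := by
  let q : FormalMultilinearSeries ℂ ℂ ℂ := fun n =>
    ContinuousMultilinearMap.mkPiRing ℂ (Fin n) (a n)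
  have : HasFPowerSeriesAt (0 : ℂ → ℂ) q 0 := by
    rw [hasFPowerSeriesAt_iff]
    refine Filter.Eventually.of_forall fun z => ?_
    simpa [q, FormalMultilinearSeries.coeff] using h z
  have h0 := congrFun this.eq_zero n
  have := congrArg (fun q => q fun _ => (1 : ℂ)) h0
  simpa [q] using this

theorem dense_expVec : Dense (Submodule.span ℂ (Set.range (expVec : H → BosonicFock H)) :
    Set (BosonicFock H)) := by
  rw [Submodule.dense_iff_topologicalClosure_eq_top, Submodule.topologicalClosure_eq_top_iff,
    Submodule.eq_bot_iff]
  intro ξ hξ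
  have h0 : ∀ v, ⟪ξ, expVec v⟫_ℂ = 0 := fun v =>
    Submodule.inner_left_of_mem_orthogonal (Submodule.subset_span (Set.mem_range_self v)) hξ
  have h1 : ∀ (v : H) (n : ℕ), ⟪incl H ξ n, tmul fun _ : Fin n => v⟫_ℂ = 0 := by
    intro v n
    have hn : ((√(n.factorial : ℝ))⁻¹ : ℂ) ≠ 0 := by
      rw [← Complex.ofReal_inv, Complex.ofReal_ne_zero]
      have : 0 < (n.factorial : ℝ) := by exact_mod_cast n.factorial_pos
      positivity
    refine (mul_eq_zero.mp (eq_zero_of_power_series (a := fun n : ℕ =>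
      ((√(n.factorial : ℝ))⁻¹ : ℂ) * ⟪incl H ξ n, tmul fun _ : Fin n => v⟫_ℂ)
      (fun t => ?_) n)).resolve_left hn
    have := lp.hasSum_inner (𝕜 := ℂ) (incl H ξ) (incl H (expVec (t • v)))
    rw [(incl H).inner_map_map, h0] at this
    have heq : ∀ m, ⟪incl H ξ m, incl H (expVec (t • v)) m⟫_ℂ =
        t ^ m * (((√(m.factorial : ℝ))⁻¹ : ℂ) * ⟪incl H ξ m, tmul fun _ : Fin m => v⟫_ℂ) := ?_
    · simpa only [heq] using this
    intro m
    rw [expVec_apply, vee_const, inner_smul_right, mul_left_comm (t ^ m)]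
    congr 1
    have := (tprod (n := m)).map_smul_univ (fun _ => t) (fun _ => v)
    rw [tmul, tmul, this, UniformSpace.Completion.coe_smul, inner_smul_right]
    simp
  refine (incl H).injective (lp.ext (funext fun n => ?_))
  rw [map_zero]
  refine eq_zero_of_inner_tmul fun v => ?_
  refine multilinear_eq_zero
    (((innerSL ℂ (incl H ξ n)).toLinearMap ∘ₗ (UniformSpace.Completion.toComplₗᵢ (𝕜 := ℂ)
      (E := AlgTensor H n)).toLinearMap).compMultilinearMap tprod) ?_ (fun v => h1 v n) v
  intro σ v
  change ⟪incl H ξ n, tmul fun i => v (σ i)⟫_ℂ = ⟪incl H ξ n, tmul v⟫_ℂ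
  rw [← inner_permOp σ.symm _ (tmul v), permOp_tmul, incl_mem ξ n σ.symm]
  rfl

/-- The vacuum vector `Exp(0)`. -/
def vacuum (H : Type u) [NormedAddCommGroup H] [InnerProductSpace ℂ H] : BosonicFock H :=
  expVec 0

/-! ### Weyl operators -/

/-- Finite linear combinations of exponential vectors. -/
def expComb (H : Type u) [NormedAddCommGroup H] [InnerProductSpace ℂ H] :
    (H →₀ ℂ) →ₗ[ℂ] BosonicFock H :=
  Finsupp.linearCombination ℂ expVec

/-- The vectors `exp(-⟪x, v⟫ - ‖x‖² / 2) Exp(v + x)`. -/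
def shiftVec (x v : H) : BosonicFock H :=
  Complex.exp (-⟪x, v⟫_ℂ - (‖x‖ ^ 2 / 2 : ℝ)) • expVec (v + x)

/-- The operator `U_x` on the bosonic Fock space, determined by
`U_x Exp(v) = exp(-⟪x, v⟫ - ‖x‖² / 2) Exp(v + x)` through linear and continuous extension. -/
def shiftOp (x : H) : BosonicFock H →L[ℂ] BosonicFock H :=
  LinearMap.extendOfNorm (Finsupp.linearCombination ℂ (shiftVec x)) (expComb H)

theorem half_norm_sq (x : H) : ((‖x‖ ^ 2 / 2 : ℝ) : ℂ) = ⟪x, x⟫_ℂ / 2 := by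
  rw [inner_self_eq_norm_sq_to_K]
  push_cast
  rfl

theorem inner_shiftVec (x v w : H) : ⟪shiftVec x v, shiftVec x w⟫_ℂ = ⟪expVec v, expVec w⟫_ℂ := by
  rw [shiftVec, shiftVec, inner_smul_left, inner_smul_right, inner_expVec, inner_expVec,
    ← Complex.exp_conj, ← Complex.exp_add, ← Complex.exp_add, half_norm_sq]
  congr 1
  simp only [inner_add_left, inner_add_right, map_sub, map_neg, map_div₀, inner_conj_symm,
    Complex.conj_ofNat]
  ring

theorem denseRange_expComb : DenseRange (expComb H) := by
  have := dense_expVec (H := H)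
  rw [DenseRange, ← LinearMap.coe_range, expComb, Finsupp.range_linearCombination]
  exact this

theorem norm_shiftComb (x : H) (c : H →₀ ℂ) :
    ‖Finsupp.linearCombination ℂ (shiftVec x) c‖ = ‖expComb H c‖ := by
  rw [@norm_eq_sqrt_re_inner ℂ, @norm_eq_sqrt_re_inner ℂ, expComb]
  simp only [Finsupp.linearCombination_apply, Finsupp.sum, sum_inner, inner_sum, inner_smul_left,
    inner_smul_right, inner_shiftVec]

/-- The defining relation of the operators `U_x`. -/
theorem shiftOp_expVec (x v : H) :
    shiftOp x (expVec v) = Complex.exp (-⟪x, v⟫_ℂ - (‖x‖ ^ 2 / 2 : ℝ)) • expVec (v + x) := by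
  have := LinearMap.extendOfNorm_eq (f := Finsupp.linearCombination ℂ (shiftVec x))
    (e := expComb H) denseRange_expComb ⟨1, fun c => by rw [norm_shiftComb, one_mul]⟩
    (Finsupp.single v 1)
  simpa [expComb, shiftVec, shiftOp] using this

theorem op_ext {S T : BosonicFock H →L[ℂ] BosonicFock H}
    (h : ∀ v, S (expVec v) = T (expVec v)) : S = T := by
  refine ContinuousLinearMap.ext_on dense_expVec ?_
  rintro _ ⟨v, rfl⟩
  exact h v

theorem shiftOp_mul (x y : H) :
    shiftOp x * shiftOp y = Complex.exp (-((⟪x, y⟫_ℂ : ℂ).im : ℂ) * Complex.I) • shiftOp (x + y) := by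
  refine op_ext fun v => ?_
  rw [mul_apply_eq_comp, smul_apply, shiftOp_expVec, map_smul,
    shiftOp_expVec, shiftOp_expVec, smul_smul, smul_smul, ← Complex.exp_add, ← Complex.exp_add,
    add_comm x y, ← add_assoc]
  congr 2
  have h : (⟪x, y⟫_ℂ : ℂ) - ⟪y, x⟫_ℂ = 2 * ((⟪x, y⟫_ℂ : ℂ).im : ℂ) * Complex.I := by
    rw [← inner_conj_symm y x, Complex.sub_conj]
    push_cast
    rfl
  simp only [half_norm_sq, inner_add_left, inner_add_right]
  linear_combination (-1 / 2) * h

theorem shiftOp_zero : shiftOp (0 : H) = 1 := op_ext fun v => by simp [shiftOp_expVec]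

theorem shiftOp_mul_neg (x : H) : shiftOp x * shiftOp (-x) = 1 := by
  have h : (⟪x, x⟫_ℂ : ℂ).im = 0 := inner_self_im (𝕜 := ℂ) x
  rw [shiftOp_mul, inner_neg_right, Complex.neg_im, h, add_neg_cancel, shiftOp_zero]
  simp

theorem norm_shiftOp (x : H) (ξ : BosonicFock H) : ‖shiftOp x ξ‖ = ‖ξ‖ := by
  have hb : ∀ c, ‖Finsupp.linearCombination ℂ (shiftVec x) c‖ ≤ 1 * ‖expComb H c‖ := fun c => by
    rw [norm_shiftComb, one_mul]
  refine denseRange_expComb.induction_on ξ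
    (isClosed_eq (by fun_prop) (by fun_prop)) fun c => ?_
  rw [shiftOp, LinearMap.extendOfNorm_eq denseRange_expComb ⟨1, hb⟩, norm_shiftComb]

theorem star_shiftOp (x : H) : star (shiftOp x) = shiftOp (-x) := by
  have h : star (shiftOp x) * shiftOp x = 1 :=
    (ContinuousLinearMap.norm_map_iff_adjoint_comp_self _).mp (norm_shiftOp x)
  calc star (shiftOp x) = star (shiftOp x) * (shiftOp x * shiftOp (-x)) := by
        rw [shiftOp_mul_neg, mul_one]
    _ = shiftOp (-x) := by rw [← mul_assoc, h, one_mul]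

theorem shiftOp_mem_unitary (x : H) : shiftOp x ∈ unitary (BosonicFock H →L[ℂ] BosonicFock H) := by
  rw [Unitary.mem_iff, star_shiftOp]
  exact ⟨by simpa using shiftOp_mul_neg (-x), shiftOp_mul_neg x⟩

/-- The Weyl operator `W(v) = U_{iv/√2}`. -/
def weyl (v : H) : BosonicFock H →L[ℂ] BosonicFock H :=
  shiftOp ((Complex.I / (√2 : ℝ)) • v)

theorem star_weyl (v : H) : star (weyl v) = weyl (-v) := by
  rw [weyl, star_shiftOp, weyl, smul_neg]

/-- The von Neumann algebra `R(V) = W(V)''` of a real subspace `V` of `H`. -/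
def weylAlgebra (V : Submodule ℝ H) : VonNeumannAlgebra (BosonicFock H) where
  toSubalgebra := Subalgebra.centralizer ℂ (Set.centralizer (weyl '' (V : Set H)))
  star_mem' := by
    intro T hT
    change star T ∈ Set.centralizer _
    have hT' : T ∈ Set.centralizer (Set.centralizer (weyl '' (V : Set H))) := hT
    rw [Set.mem_centralizer_iff] at hT' ⊢
    intro S hS
    have hS' : star S ∈ Set.centralizer (weyl '' (V : Set H)) := by
      rw [Set.mem_centralizer_iff] at hS ⊢
      rintro _ ⟨v, hv, rfl⟩
      have := congrArg star (hS (weyl (-v)) ⟨-v, V.neg_mem hv, rfl⟩)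
      simpa [star_weyl] using this.symm
    simpa using (congrArg star (hT' _ hS')).symm
  centralizer_centralizer' := by
    change Set.centralizer (Set.centralizer (Set.centralizer (Set.centralizer _))) =
      Set.centralizer (Set.centralizer _)
    rw [Set.centralizer_centralizer_centralizer]

theorem coe_weylAlgebra (V : Submodule ℝ H) :
    (weylAlgebra V : Set (BosonicFock H →L[ℂ] BosonicFock H)) =
      Set.centralizer (Set.centralizer (weyl '' (V : Set H))) := rfl

/-! ### The Heisenberg group -/

/-- The Heisenberg group `𝕋 × H` with `(z, v) (z', v') = (z z' exp(-i Im ⟪v, v'⟫), v + v')`. -/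
@[ext]
structure Heis (H : Type u) where
  /-- The central component. -/
  phase : Circle
  /-- The vector component. -/
  vec : H

namespace Heis

instance : One (Heis H) := ⟨⟨1, 0⟩⟩

instance : Mul (Heis H) :=
  ⟨fun g h => ⟨g.phase * h.phase * Circle.exp (-(⟪g.vec, h.vec⟫_ℂ : ℂ).im), g.vec + h.vec⟩⟩

instance : Inv (Heis H) := ⟨fun g => ⟨g.phase⁻¹, -g.vec⟩⟩

theorem mul_def (g h : Heis H) :
    g * h = ⟨g.phase * h.phase * Circle.exp (-(⟪g.vec, h.vec⟫_ℂ : ℂ).im), g.vec + h.vec⟩ := rfl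

instance : Group (Heis H) :=
  Group.ofLeftAxioms
    (by
      intro a b c
      simp only [mul_def]
      ext1
      · simp only [inner_add_left, inner_add_right, Complex.add_im, neg_add, Circle.exp_add]
        simp only [mul_assoc, mul_left_comm, mul_comm]
      · exact add_assoc _ _ _)
    (by
      intro a
      change (⟨1 * a.phase * Circle.exp (-(⟪(0 : H), a.vec⟫_ℂ : ℂ).im), 0 + a.vec⟩ : Heis H) = a
      simp)
    (by
      intro a
      have h : (⟪a.vec, a.vec⟫_ℂ : ℂ).im = 0 := inner_self_im (𝕜 := ℂ) a.vec
      change (⟨a.phase⁻¹ * a.phase * Circle.exp (-(⟪-a.vec, a.vec⟫_ℂ : ℂ).im), -a.vec + a.vec⟩ :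
        Heis H) = ⟨1, 0⟩
      rw [inner_neg_left, Complex.neg_im, h]
      simp)

end Heis

/-- The unitary representation `U_{(z, v)} = z U_v` of the Heisenberg group on the bosonic Fock
space. -/
def heisRep (H : Type u) [NormedAddCommGroup H] [InnerProductSpace ℂ H] :
    Heis H →* unitary (BosonicFock H →L[ℂ] BosonicFock H) where
  toFun g := ⟨(g.phase : ℂ) • shiftOp g.vec, by
    have h := Unitary.mem_iff.mp (shiftOp_mem_unitary g.vec)
    have hz : (starRingEnd ℂ) (g.phase : ℂ) * g.phase = 1 := by
      rw [Complex.conj_mul', Circle.norm_coe]; simp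
    rw [Unitary.mem_iff, star_smul, smul_mul_smul_comm, smul_mul_smul_comm, h.1, h.2,
      mul_comm (g.phase : ℂ)]
    exact ⟨by rw [← starRingEnd_apply, hz, one_smul], by rw [← starRingEnd_apply, hz, one_smul]⟩⟩
  map_one' := by
    ext1
    change ((1 : Circle) : ℂ) • shiftOp (0 : H) = 1
    rw [shiftOp_zero, Circle.coe_one, one_smul]
  map_mul' g h := by
    ext1
    change ((g * h).phase : ℂ) • shiftOp (g * h).vec =
      ((g.phase : ℂ) • shiftOp g.vec) * ((h.phase : ℂ) • shiftOp h.vec)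
    rw [smul_mul_smul_comm, shiftOp_mul, smul_smul, Heis.mul_def]
    simp only [Circle.coe_mul, Circle.coe_exp, Complex.ofReal_neg]

/-- A unitary representation on a Hilbert space `E` is irreducible if `E ≠ 0` and `0` and `E` are
the only closed invariant subspaces. -/
def IsIrreducibleRep {G E : Type*} [Group G] [NormedAddCommGroup E] [InnerProductSpace ℂ E]
    [CompleteSpace E] (ρ : G →* unitary (E →L[ℂ] E)) : Prop :=
  Nontrivial E ∧ ∀ K : Submodule ℂ E, IsClosed (K : Set E) →
    (∀ g : G, ∀ x ∈ K, (ρ g : E →L[ℂ] E) x ∈ K) → K = ⊥ ∨ K = ⊤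

/-! ### Real subspaces -/

/-- The symplectic orthogonal space `V' = {w | ∀ v ∈ V, Im ⟪v, w⟫ = 0}`. -/
def sympCompl (V : Submodule ℝ H) : Submodule ℝ H where
  carrier := {w | ∀ v ∈ V, (⟪v, w⟫_ℂ : ℂ).im = 0}
  add_mem' := by
    intro a b ha hb v hv
    rw [inner_add_right, Complex.add_im, ha v hv, hb v hv, add_zero]
  zero_mem' := by intro v _; simp
  smul_mem' := by
    intro c x hx v hv
    rw [RCLike.real_smul_eq_coe_smul (K := ℂ), inner_smul_right]
    simp [hx v hv]

/-- The real subspace `iV`. -/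
def mulI (V : Submodule ℝ H) : Submodule ℝ H :=
  V.map ((Complex.I • (LinearMap.id : H →ₗ[ℂ] H)).restrictScalars ℝ)

/-- Standard subspaces: closed real subspaces with `V ∩ iV = 0` and `V + iV` dense. -/
def IsStandard (V : Submodule ℝ H) : Prop :=
  IsClosed (V : Set H) ∧ V ⊓ mulI V = ⊥ ∧ Dense ((V ⊔ mulI V : Submodule ℝ H) : Set H)

/-! ### Cyclic and separating vectors -/

/-- The unit vector `ξ` is cyclic for `M`: the subspace `M ξ` is dense. -/
def IsCyclicVector {E : Type*} [NormedAddCommGroup E] [InnerProductSpace ℂ E] [CompleteSpace E]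
    (M : VonNeumannAlgebra E) (ξ : E) : Prop :=
  ‖ξ‖ = 1 ∧ Dense {x : E | ∃ T ∈ M, x = T ξ}

/-- The unit vector `ξ` is separating for `M`: the map `M → E`, `T ↦ T ξ` is injective. -/
def IsSeparatingVector {E : Type*} [NormedAddCommGroup E] [InnerProductSpace ℂ E]
    [CompleteSpace E] (M : VonNeumannAlgebra E) (ξ : E) : Prop :=
  ‖ξ‖ = 1 ∧ Set.InjOn (fun T : E →L[ℂ] E => T ξ) (M : Set (E →L[ℂ] E))

/-- The set `cs(M)` of cyclic and separating unit vectors of `M`. -/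
def cyclicSeparating {E : Type*} [NormedAddCommGroup E] [InnerProductSpace ℂ E]
    [CompleteSpace E] (M : VonNeumannAlgebra E) : Set E :=
  {ξ | IsCyclicVector M ξ ∧ IsSeparatingVector M ξ}

end BoseFock

end

namespace BoseFock

universe u

/-! ### Generalities on von Neumann algebras -/

section VonNeumann

variable {E : Type*} [NormedAddCommGroup E] [InnerProductSpace ℂ E] [CompleteSpace E]

/-! Everything is read off from matrix elements against exponential vectors, which span a dense
subspace and satisfy `⟪Exp v, Exp w⟫ = exp ⟪v, w⟫`. For fixed `ξ` the function `z ↦ ⟪ξ, Exp(z v)⟫`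
is entire, and this holomorphy drives the argument.

Irreducibility. If `T` commutes with `U_x`, then `⟪Ω, T Exp(x)⟫ = ⟪Exp(-x), T Ω⟫`. Along a complex
line `x = z w` the left side is holomorphic in `z` and the right side antiholomorphic, so both are
constant and `⟪Exp w, T Ω⟫ = ⟪Ω, T Ω⟫` (`inner_expVec_apply_vacuum`). An operator commuting with all
`U_x` therefore maps `Ω` to a multiple of `Ω`, and so is a scalar.

Locality is the Weyl relation with `v` rescaled to detect the phase. Passage to the closure holds
because the `x` for which `U_x` commutes with `T` form a closed set (`isClosed_commute`).

Cyclicity. A vector orthogonal to `R(V) Ω` is orthogonal to `Exp(c v)` for `v ∈ V`, where `c =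
i/√2`. Analytic continuation extends this to `V + iV`, and continuity to the closure. Conversely, if
`w` is orthogonal to `V`, then `Exp(w) - Ω` is orthogonal to `R(V) Ω` (`orbit_vacuum_le`).

Separation. If `V̄ ∩ iV̄ = 0`, then `V' + iV'` is dense, so `Ω` is cyclic for `R(V') ⊆ R(V)'` and
separating for `R(V)`. The inclusion suffices; the duality `R(V)' = R(V')` is not needed.
Conversely, a vector `w ∈ V̄ ∩ iV̄` spans a complex line in `V̄`, so `Exp(w) - Ω` is orthogonal to
`R(V)' Ω`, which is dense when `Ω` is separating. -/

/-- The subspace `M ξ`. -/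
noncomputable def orbit (M : VonNeumannAlgebra E) (ξ : E) : Submodule ℂ E :=
  M.toStarSubalgebra.toSubalgebra.toSubmodule.map (ContinuousLinearMap.apply ℂ E ξ).toLinearMap

theorem coe_orbit (M : VonNeumannAlgebra E) (ξ : E) :
    (orbit M ξ : Set E) = {x | ∃ T ∈ M, x = T ξ} := by
  ext x
  exact ⟨fun ⟨T, hT, h⟩ => ⟨T, hT, h.symm⟩, fun ⟨T, hT, h⟩ => ⟨T, hT, h.symm⟩⟩

theorem mem_orbit {M : VonNeumannAlgebra E} {ξ : E} {T : E →L[ℂ] E} (hT : T ∈ M) :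
    T ξ ∈ orbit M ξ :=
  ⟨T, hT, rfl⟩

/-- The projection onto a closed subspace invariant under `T` and its adjoint commutes with `T`. -/
theorem starProjection_mul_comm {K : Submodule ℂ E} [K.HasOrthogonalProjection] {T : E →L[ℂ] E}
    (h : ∀ x ∈ K, T x ∈ K) (h' : ∀ x ∈ K, star T x ∈ K) :
    K.starProjection * T = T * K.starProjection := by
  ext x
  change K.starProjection (T x) = T (K.starProjection x)
  refine Submodule.eq_starProjection_of_mem_orthogonal (h _ (K.starProjection_apply_mem x)) ?_
  -- Since the adjoint preserves `K`, the operator `T` preserves the orthogonal complement of `K`.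
  rw [← map_sub]
  intro y hy
  rw [← ContinuousLinearMap.adjoint_inner_left]
  exact K.sub_starProjection_mem_orthogonal x _ (h' y hy)

theorem isCyclicVector_iff {M : VonNeumannAlgebra E} {ξ : E} (hξ : ‖ξ‖ = 1) :
    IsCyclicVector M ξ ↔ ∀ η : E, (∀ T ∈ M, ⟪η, T ξ⟫_ℂ = 0) → η = 0 := by
  rw [IsCyclicVector, and_iff_right hξ, ← coe_orbit,
    Submodule.dense_iff_topologicalClosure_eq_top, Submodule.topologicalClosure_eq_top_iff,
    Submodule.eq_bot_iff]
  refine forall_congr' fun η => imp_congr_left ?_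
  rw [Submodule.mem_orthogonal']
  exact ⟨fun h T hT => h _ (mem_orbit hT), fun h _ ⟨T, hT, hx⟩ => hx ▸ h T hT⟩

/-- An element `S` of `M` is determined on the dense subspace `N ξ` by `S ξ`, because `S R ξ = R S
ξ` for `R ∈ N`. -/
theorem isSeparatingVector_of_isCyclicVector {M N : VonNeumannAlgebra E} {ξ : E}
    (hN : N ≤ M.commutant) (h : IsCyclicVector N ξ) : IsSeparatingVector M ξ := by
  refine ⟨h.1, fun S hS T hT hST => ?_⟩
  refine ContinuousLinearMap.coeFn_injective
    (Continuous.ext_on h.2 S.continuous T.continuous ?_)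
  rintro _ ⟨R, hR, rfl⟩
  have hR' := VonNeumannAlgebra.mem_commutant_iff.mp (hN hR)
  calc S (R ξ) = R (S ξ) := congrArg (fun A => A ξ) (hR' S hS)
    _ = R (T ξ) := congrArg R hST
    _ = T (R ξ) := (congrArg (fun A => A ξ) (hR' T hT)).symm

/-- The projection onto the closure of `M' ξ` commutes with `M'`, so it lies in `M'' = M`. It agrees
with `1` on `ξ`, hence equals `1`. -/
theorem isCyclicVector_commutant {M : VonNeumannAlgebra E} {ξ : E}
    (h : IsSeparatingVector M ξ) : IsCyclicVector M.commutant ξ := by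
  refine ⟨h.1, ?_⟩
  rw [← coe_orbit, Submodule.dense_iff_topologicalClosure_eq_top]
  set K := (orbit M.commutant ξ).topologicalClosure with hK
  have inv : ∀ T ∈ M.commutant, ∀ x ∈ K, T x ∈ K := by
    intro T hT x hx
    refine map_mem_closure T.continuous hx ?_
    rintro _ ⟨R, hR, rfl⟩
    exact mem_orbit (M := M.commutant) (T := T * R) (mul_mem hT hR)
  have : CompleteSpace K := (Submodule.isClosed_topologicalClosure _).completeSpace_coe
  have hP : K.starProjection ∈ M := by
    rw [← M.commutant_commutant, VonNeumannAlgebra.mem_commutant_iff]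
    exact fun T hT => (starProjection_mul_comm (inv T hT) (inv _ (star_mem hT))).symm
  have hξ : ξ ∈ K := Submodule.le_topologicalClosure _
    (mem_orbit (M := M.commutant) (T := 1) (one_mem _))
  have h1 : K.starProjection = 1 := h.2 hP (one_mem M) (K.starProjection_eq_self_iff.mpr hξ)
  refine Submodule.eq_top_iff'.mpr fun x => K.starProjection_eq_self_iff.mp ?_
  rw [h1]
  rfl

end VonNeumann

/-! ### Holomorphy -/

/-- A holomorphic function with holomorphic conjugate is constant. -/
theorem eq_of_differentiable_conj {f : ℂ → ℂ} (hf : Differentiable ℂ f)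
    (hg : Differentiable ℂ fun z => (starRingEnd ℂ) (f z)) (z w : ℂ) : f z = f w := by
  refine is_const_of_deriv_eq_zero hf (fun z => ?_) z w
  have h1 := (hf z).hasDerivAt.hasFDerivAt.restrictScalars ℝ
  have h2 := (hg z).hasDerivAt.hasFDerivAt.restrictScalars ℝ
  -- The real differential of the conjugate is conjugation after that of `f`. The directions `1` and
  -- `I` give opposite signs, which forces the derivative to vanish.
  have h3 := h2.unique (Complex.conjCLE.toContinuousLinearMap.hasFDerivAt.comp z h1)
  have e1 := congrArg (fun A => A 1) h3
  have eI := congrArg (fun A => A Complex.I) h3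
  simp at e1 eI
  rw [e1] at eI
  have h0 : (starRingEnd ℂ) (deriv f z) * (2 * Complex.I) = 0 := by linear_combination eI
  simpa using h0

theorem differentiable_of_hasSum_pow {f : ℂ → ℂ} {a : ℕ → ℂ}
    (h : ∀ t : ℂ, HasSum (fun n => t ^ n * a n) (f t)) : Differentiable ℂ f := by
  let q : FormalMultilinearSeries ℂ ℂ ℂ := fun n =>
    ContinuousMultilinearMap.mkPiRing ℂ (Fin n) (a n)
  -- Summability at every real `r ≥ 0` already gives an infinite radius of convergence.
  have hq : q.radius = ⊤ := by
    refine q.radius_eq_top_of_summable_norm fun r => ?_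
    refine (h (r : ℝ)).summable.norm.congr fun n => ?_
    simp [q, mul_comm]
  have : HasFPowerSeriesOnBall f q 0 ⊤ := by
    refine ⟨hq.ge, by simp, fun {y} _ => ?_⟩
    simpa [q] using h y
  have hd := this.differentiableOn
  intro z
  exact hd.differentiableAt (by simp)

/-! ### Continuity and holomorphy of exponential vectors -/

variable {H : Type u} [NormedAddCommGroup H] [InnerProductSpace ℂ H]

/-- The distance between two exponential vectors is expressed by the continuous kernel `exp ⟪·, ·⟫`.
-/
theorem continuous_expVec : Continuous (expVec : H → BosonicFock H) := by
  rw [continuous_iff_continuousAt]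
  intro w
  rw [ContinuousAt, tendsto_iff_norm_sub_tendsto_zero]
  have key : ∀ v : H, ‖expVec v - expVec w‖ = √(Complex.re (Complex.exp ⟪v, v⟫_ℂ -
      Complex.exp ⟪v, w⟫_ℂ - (Complex.exp ⟪w, v⟫_ℂ - Complex.exp ⟪w, w⟫_ℂ))) := by
    intro v
    rw [@norm_eq_sqrt_re_inner ℂ]
    simp only [inner_sub_left, inner_sub_right, inner_expVec]
    congr 1
    rw [RCLike.re_to_complex]
    congr 1
    ring
  simp only [key]
  have hc : Continuous fun v : H => √(Complex.re (Complex.exp ⟪v, v⟫_ℂ -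
      Complex.exp ⟪v, w⟫_ℂ - (Complex.exp ⟪w, v⟫_ℂ - Complex.exp ⟪w, w⟫_ℂ))) := by fun_prop
  simpa using hc.tendsto w

/-- The `n`-th component of `Exp(t v)` is `tⁿ v^{⊗n} / √(n!)`, so the matrix element is an
everywhere convergent power series in `t`. -/
theorem differentiable_inner_expVec_smul (ξ : BosonicFock H) (v : H) :
    Differentiable ℂ fun z : ℂ => ⟪ξ, expVec (z • v)⟫_ℂ := by
  refine differentiable_of_hasSum_pow (a := fun n : ℕ =>
      ((√(n.factorial : ℝ))⁻¹ : ℂ) * ⟪incl H ξ n, tmul fun _ : Fin n => v⟫_ℂ) fun t => ?_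
  have h := lp.hasSum_inner (𝕜 := ℂ) (incl H ξ) (incl H (expVec (t • v)))
  rw [(incl H).inner_map_map] at h
  refine h.congr_fun fun m => ?_
  rw [expVec_apply, vee_const, inner_smul_right, mul_left_comm (t ^ m)]
  congr 1
  have := (tprod (n := m)).map_smul_univ (fun _ => t) (fun _ => v)
  rw [tmul, tmul, this, UniformSpace.Completion.coe_smul, inner_smul_right]
  simp

theorem expVec_add (x v : H) :
    expVec (v + x) = Complex.exp (⟪x, v⟫_ℂ + (‖x‖ ^ 2 / 2 : ℝ)) • shiftOp x (expVec v) := by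
  rw [shiftOp_expVec, smul_smul, ← Complex.exp_add]
  simp

theorem expVec_eq_shiftOp_vacuum (x : H) :
    expVec x = Complex.exp (‖x‖ ^ 2 / 2 : ℝ) • shiftOp x (vacuum H) := by
  simpa [vacuum] using expVec_add x 0

theorem inner_shiftOp_left (x : H) (ξ η : BosonicFock H) :
    ⟪shiftOp x ξ, η⟫_ℂ = ⟪ξ, shiftOp (-x) η⟫_ℂ := by
  rw [← star_shiftOp, ContinuousLinearMap.star_eq_adjoint, ContinuousLinearMap.adjoint_inner_right]

/-- The translation by `x` is moved onto `ξ` as `U_{-x}`, at the cost of an exponential factor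
entire in `z`. This reduces affine complex lines to lines through the origin. -/
theorem differentiable_inner_expVec_add_smul (ξ : BosonicFock H) (x v : H) :
    Differentiable ℂ fun z : ℂ => ⟪ξ, expVec (z • v + x)⟫_ℂ := by
  have h : ∀ z : ℂ, ⟪ξ, expVec (z • v + x)⟫_ℂ = Complex.exp (z * ⟪x, v⟫_ℂ + (‖x‖ ^ 2 / 2 : ℝ)) *
      ⟪shiftOp (-x) ξ, expVec (z • v)⟫_ℂ := by
    intro z
    rw [expVec_add, inner_smul_right, inner_smul_right, inner_shiftOp_left, neg_neg]
  simp only [h]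
  have := differentiable_inner_expVec_smul (shiftOp (-x) ξ) v
  fun_prop

/-- An entire function vanishing on the real line is zero. -/
theorem eq_zero_of_real {f : ℂ → ℂ} (hf : Differentiable ℂ f) (h : ∀ t : ℝ, f t = 0) (z : ℂ) :
    f z = 0 := by
  have hA : AnalyticOnNhd ℂ f Set.univ := fun z _ => hf.analyticAt z
  refine hA.eqOn_zero_of_preconnected_of_frequently_eq_zero isPreconnected_univ
    (Set.mem_univ (0 : ℂ)) ?_ (Set.mem_univ z)
  -- Punctured real neighbourhoods of `0` map into punctured complex ones, so the zeros of `f`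
  -- accumulate at `0`.
  have ht : Filter.Tendsto (fun t : ℝ => (t : ℂ)) (nhdsWithin 0 {0}ᶜ) (nhdsWithin 0 {0}ᶜ) := by
    refine tendsto_nhdsWithin_iff.mpr ⟨?_, ?_⟩
    · exact (Complex.continuous_ofReal.tendsto' 0 0 Complex.ofReal_zero).mono_left
        nhdsWithin_le_nhds
    · filter_upwards [self_mem_nhdsWithin] with t ht
      simpa using ht
  exact ht.frequently (Filter.Eventually.of_forall h).frequently

/-! ### Operators commuting with Weyl operators -/

theorem norm_vacuum : ‖vacuum H‖ = 1 := by
  rw [@norm_eq_sqrt_re_inner ℂ, vacuum, inner_expVec]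
  simp

/-- The normalising factor relating `Exp(±x)` to `U_{±x} Ω` is real and the same for both signs, so
it survives moving `U_x` across the scalar product unchanged. -/
theorem inner_vacuum_expVec_of_commute {T : BosonicFock H →L[ℂ] BosonicFock H} {x : H}
    (h : shiftOp x * T = T * shiftOp x) :
    ⟪vacuum H, T (expVec x)⟫_ℂ = ⟪expVec (-x), T (vacuum H)⟫_ℂ := by
  have h' : shiftOp x (T (vacuum H)) = T (shiftOp x (vacuum H)) :=
    congrArg (fun A => A (vacuum H)) h
  rw [expVec_eq_shiftOp_vacuum x, expVec_eq_shiftOp_vacuum (-x), map_smul, ← h', inner_smul_right,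
    inner_smul_left, inner_shiftOp_left, neg_neg, ← Complex.exp_conj, Complex.conj_ofReal, norm_neg]

/-- If `T` commutes with the Weyl operators of a complex line, then `T Ω` is, on that line,
indistinguishable from a multiple of `Ω`. -/
theorem inner_expVec_apply_vacuum {T : BosonicFock H →L[ℂ] BosonicFock H} {w : H}
    (h : ∀ z : ℂ, shiftOp (z • w) * T = T * shiftOp (z • w)) :
    ⟪expVec w, T (vacuum H)⟫_ℂ = ⟪vacuum H, T (vacuum H)⟫_ℂ := by
  have e : ∀ z : ℂ, ⟪vacuum H, T (expVec (z • w))⟫_ℂ = ⟪expVec (z • -w), T (vacuum H)⟫_ℂ :=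
    fun z => by rw [inner_vacuum_expVec_of_commute (h z), smul_neg]
  have h1 : Differentiable ℂ fun z : ℂ => ⟪vacuum H, T (expVec (z • w))⟫_ℂ := by
    simp only [← ContinuousLinearMap.adjoint_inner_left]
    exact differentiable_inner_expVec_smul _ w
  have h2 : Differentiable ℂ fun z : ℂ =>
      (starRingEnd ℂ) ⟪vacuum H, T (expVec (z • w))⟫_ℂ := by
    simp only [e, inner_conj_symm]
    exact differentiable_inner_expVec_smul _ (-w)
  -- By `e`, the value at `-1` is the matrix element with `Exp(w)`, and the value at `0` is the one
  -- with `Ω`.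
  have := eq_of_differentiable_conj h1 h2 (-1) 0
  simp only [e] at this
  simpa [vacuum] using this

/-- As `⟪Exp w, Ω⟫ = 1` for every `w`, constancy of `⟪Exp w, T Ω⟫` means `T Ω = c Ω`. Each
exponential vector is a multiple of some `U_v Ω`, so commutation carries the scalar `c` to all of
them. -/
theorem exists_smul_one_of_commute {T : BosonicFock H →L[ℂ] BosonicFock H}
    (h : ∀ x : H, shiftOp x * T = T * shiftOp x) : ∃ c : ℂ, T = c • 1 := by
  have h0 : T (vacuum H) = ⟪vacuum H, T (vacuum H)⟫_ℂ • vacuum H := by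
    refine dense_expVec.eq_of_inner_right ℂ fun v hv => ?_
    induction hv using Submodule.span_induction with
    | mem x hx =>
      obtain ⟨w, rfl⟩ := hx
      rw [inner_expVec_apply_vacuum fun z => h _, inner_smul_right]
      conv_rhs => rw [vacuum, inner_expVec]
      simp [vacuum]
    | zero => simp
    | add x y _ _ hx hy => rw [inner_add_left, inner_add_left, hx, hy]
    | smul c x _ hx => rw [inner_smul_left, inner_smul_left, hx]
  refine ⟨⟪vacuum H, T (vacuum H)⟫_ℂ, op_ext fun v => ?_⟩
  have h' : shiftOp v (T (vacuum H)) = T (shiftOp v (vacuum H)) :=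
    congrArg (fun A => A (vacuum H)) (h v)
  rw [expVec_eq_shiftOp_vacuum, map_smul, ← h']
  set c := ⟪vacuum H, T (vacuum H)⟫_ℂ
  rw [h0, map_smul, smul_comm]
  rfl

/-- In this form `x` enters only through exponential vectors and scalar factors, so closedness in
`x` follows from `continuous_expVec` without strong continuity of `x ↦ U_x`. -/
theorem commute_iff_inner {T : BosonicFock H →L[ℂ] BosonicFock H} {x : H} :
    shiftOp x * T = T * shiftOp x ↔ ∀ v w : H,
      ⟪shiftOp (-x) (expVec v), T (expVec w)⟫_ℂ = ⟪expVec v, T (shiftOp x (expVec w))⟫_ℂ := by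
  have e : ∀ v w : H, ⟪shiftOp (-x) (expVec v), T (expVec w)⟫_ℂ =
      ⟪expVec v, (shiftOp x * T) (expVec w)⟫_ℂ := fun v w => by
    rw [inner_shiftOp_left, neg_neg]; rfl
  simp only [e]
  constructor
  · intro h v w
    rw [h]; rfl
  · intro h
    refine op_ext fun w => dense_expVec.eq_of_inner_right ℂ fun ξ hξ => ?_
    induction hξ using Submodule.span_induction with
    | mem x hx => obtain ⟨v, rfl⟩ := hx; exact h v w
    | zero => simp
    | add x y _ _ hx hy => rw [inner_add_left, inner_add_left, hx, hy]
    | smul c x _ hx => rw [inner_smul_left, inner_smul_left, hx]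

theorem isClosed_commute (T : BosonicFock H →L[ℂ] BosonicFock H) :
    IsClosed {x : H | shiftOp x * T = T * shiftOp x} := by
  have hc := continuous_expVec (H := H)
  simp only [commute_iff_inner, Set.ofPred_forall]
  refine isClosed_iInter fun v => isClosed_iInter fun w => ?_
  simp only [shiftOp_expVec]
  exact isClosed_eq (by fun_prop) (by fun_prop)

/-! ### The algebras `R(V)` -/

/-- The commutant `W(V)'`. -/
theorem mem_centralizer_weyl {V : Submodule ℝ H} {T : BosonicFock H →L[ℂ] BosonicFock H} :
    T ∈ Set.centralizer (weyl '' (V : Set H)) ↔ ∀ v ∈ V, weyl v * T = T * weyl v := by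
  simp [Set.mem_centralizer_iff]

theorem mem_commutant_weylAlgebra {V : Submodule ℝ H}
    {T : BosonicFock H →L[ℂ] BosonicFock H} :
    T ∈ (weylAlgebra V).commutant ↔ ∀ v ∈ V, weyl v * T = T * weyl v := by
  rw [← mem_centralizer_weyl, ← SetLike.mem_coe, VonNeumannAlgebra.coe_commutant, coe_weylAlgebra,
    Set.centralizer_centralizer_centralizer]

theorem weyl_mem {V : Submodule ℝ H} {v : H} (hv : v ∈ V) : weyl v ∈ weylAlgebra V :=
  Set.subset_centralizer_centralizer ⟨v, hv, rfl⟩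

theorem weylAlgebra_le {V : Submodule ℝ H}
    {M : VonNeumannAlgebra (BosonicFock H)} (h : ∀ v ∈ V, weyl v ∈ M) : weylAlgebra V ≤ M := by
  have h1 : weyl '' (V : Set H) ⊆ M := by rintro _ ⟨v, hv, rfl⟩; exact h v hv
  have h2 := Set.centralizer_subset (Set.centralizer_subset h1)
  rw [VonNeumannAlgebra.centralizer_centralizer] at h2
  exact h2

theorem weylAlgebra_mono {V W : Submodule ℝ H} (h : V ≤ W) : weylAlgebra V ≤ weylAlgebra W :=
  weylAlgebra_le fun _ hv => weyl_mem (h hv)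

theorem weyl_mul (v w : H) : weyl v * weyl w =
    Complex.exp (-((⟪v, w⟫_ℂ : ℂ).im / 2 : ℝ) * Complex.I) • weyl (v + w) := by
  rw [weyl, weyl, shiftOp_mul, weyl, smul_add]
  have h : ⟪(Complex.I / (√2 : ℝ)) • v, (Complex.I / (√2 : ℝ)) • w⟫_ℂ = ⟪v, w⟫_ℂ / (2 : ℝ) := by
    have h2 : ((√2 : ℝ) : ℂ) * ((√2 : ℝ) : ℂ) = (2 : ℝ) := by
      rw [← Complex.ofReal_mul, Real.mul_self_sqrt zero_le_two]
    have h3 : ((√2 : ℝ) : ℂ) ≠ 0 := fun h0 => by simp [h0] at h2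
    rw [inner_smul_left, inner_smul_right, map_div₀, Complex.conj_I, Complex.conj_ofReal, ← h2]
    field_simp
    rw [Complex.I_sq]
    ring
  rw [h, Complex.div_ofReal_im]

theorem weyl_mul_comm_iff (v w : H) : weyl v * weyl w = weyl w * weyl v ↔
    Complex.exp ((⟪v, w⟫_ℂ : ℂ).im * Complex.I) = 1 := by
  have hs : (⟪w, v⟫_ℂ : ℂ).im = -(⟪v, w⟫_ℂ : ℂ).im := by
    rw [← inner_conj_symm, Complex.conj_im]
  -- Both products are scalar multiples of this nonzero operator, so commutation reduces to
  -- comparing phases.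
  have hne : weyl (v + w) ≠ 0 := by
    intro h0
    have := norm_shiftOp ((Complex.I / (√2 : ℝ)) • (v + w)) (vacuum H)
    rw [← weyl, h0, norm_vacuum] at this
    simp at this
  rw [weyl_mul, weyl_mul w v, add_comm w v, hs, (smul_left_injective ℂ hne).eq_iff, eq_comm,
    ← mul_inv_eq_one₀ (Complex.exp_ne_zero _), ← Complex.exp_neg, ← Complex.exp_add]
  congr! 2
  push_cast
  ring

theorem weyl_mul_comm_of_im_eq_zero {v w : H} (h : (⟪v, w⟫_ℂ : ℂ).im = 0) :
    weyl v * weyl w = weyl w * weyl v := by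
  rw [weyl_mul_comm_iff, h]
  simp

/-- A single commutation relation fixes `Im ⟪v, w⟫` only modulo `2π`; the real multiples of `v`
remove the ambiguity. -/
theorem im_inner_eq_zero {v w : H} (h : ∀ t : ℝ, weyl (t • v) * weyl w = weyl w * weyl (t • v)) :
    (⟪v, w⟫_ℂ : ℂ).im = 0 := by
  by_contra hne
  -- This scaling makes the phase `exp(iπ) = -1`.
  have := (weyl_mul_comm_iff _ _).mp (h (Real.pi / (⟪v, w⟫_ℂ : ℂ).im))
  rw [RCLike.real_smul_eq_coe_smul (K := ℂ), inner_smul_left] at this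
  simp only [Complex.coe_algebraMap, Complex.conj_ofReal, Complex.im_ofReal_mul,
    div_mul_cancel₀ _ hne, Complex.exp_pi_mul_I] at this
  norm_num at this

theorem weylAlgebra_le_commutant_iff (V W : Submodule ℝ H) :
    weylAlgebra V ≤ (weylAlgebra W).commutant ↔ V ≤ sympCompl W := by
  constructor
  · intro h v hv w hw
    refine im_inner_eq_zero fun t => ?_
    exact mem_commutant_weylAlgebra.mp (h (weyl_mem hv)) _ (W.smul_mem t hw)
  · intro h
    refine weylAlgebra_le fun v hv => mem_commutant_weylAlgebra.mpr fun w hw => ?_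
    exact weyl_mul_comm_of_im_eq_zero (h hv w hw)

theorem weylAlgebra_topologicalClosure (V : Submodule ℝ H) :
    weylAlgebra V = weylAlgebra V.topologicalClosure := by
  refine le_antisymm (weylAlgebra_mono V.le_topologicalClosure)
    (weylAlgebra_le fun v hv => ?_)
  rw [← (weylAlgebra V).commutant_commutant, VonNeumannAlgebra.mem_commutant_iff]
  intro T hT
  rw [mem_commutant_weylAlgebra] at hT
  have hcl : IsClosed {x : H | weyl x * T = T * weyl x} :=
    (isClosed_commute T).preimage (f := fun x : H => (Complex.I / (√2 : ℝ)) • x) (by fun_prop)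
  exact (closure_minimal hT hcl hv).symm

theorem I_div_sqrt_two_ne_zero : (Complex.I / (√2 : ℝ) : ℂ) ≠ 0 := by
  simp

/-- The factor `i/√2` between `W` and `U` is imaginary, so the two families agree along a full
complex line but not along a real one. -/
theorem commute_shiftOp_of_commute_weyl {T : BosonicFock H →L[ℂ] BosonicFock H} {w : H}
    (h : ∀ z : ℂ, weyl (z • w) * T = T * weyl (z • w)) (z : ℂ) :
    shiftOp (z • w) * T = T * shiftOp (z • w) := by
  have := h ((Complex.I / (√2 : ℝ))⁻¹ * z)
  rwa [weyl, smul_smul, mul_inv_cancel_left₀ I_div_sqrt_two_ne_zero] at this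

theorem coe_weylAlgebra_top : (weylAlgebra (⊤ : Submodule ℝ H) :
    Set (BosonicFock H →L[ℂ] BosonicFock H)) = Set.univ := by
  rw [coe_weylAlgebra, Set.eq_univ_iff_forall]
  intro S T hT
  rw [mem_centralizer_weyl] at hT
  obtain ⟨c, rfl⟩ := exists_smul_one_of_commute fun x => by
    simpa using commute_shiftOp_of_commute_weyl (w := x) (fun z => hT _ trivial) 1
  simp

theorem isIrreducibleRep_heisRep : IsIrreducibleRep (heisRep H) := by
  refine ⟨⟨vacuum H, 0, fun h => ?_⟩, fun K hK inv => ?_⟩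
  · have := norm_vacuum (H := H)
    rw [h] at this
    simp at this
  have hU : ∀ (x : H), ∀ ξ ∈ K, shiftOp x ξ ∈ K := by
    intro x ξ hξ
    have := inv ⟨1, x⟩ ξ hξ
    change (((1 : Circle) : ℂ) • shiftOp x) ξ ∈ K at this
    rwa [Circle.coe_one, one_smul] at this
  have : CompleteSpace K := hK.completeSpace_coe
  -- Schur's argument: the projection onto an invariant subspace commutes with every `U_x`, as `U_x*
  -- = U_{-x}` also preserves the subspace.
  obtain ⟨c, hc⟩ := exists_smul_one_of_commute (T := K.starProjection) fun x =>
    (starProjection_mul_comm (hU x) (by rw [star_shiftOp]; exact hU (-x))).symm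
  by_cases h0 : c = 0
  · left
    rw [Submodule.eq_bot_iff]
    intro ξ hξ
    rw [← K.starProjection_eq_self_iff.mpr hξ, hc, h0]
    simp
  · right
    rw [Submodule.eq_top_iff']
    intro ξ
    have h1 := K.starProjection_apply_mem (c⁻¹ • ξ)
    rw [hc] at h1
    simpa [smul_smul, h0] using h1

/-! ### Real subspaces -/

theorem mem_mulI {V : Submodule ℝ H} {w : H} : w ∈ mulI V ↔ ∃ v ∈ V, Complex.I • v = w := by
  simp [mulI]

/-- For the real scalar product `Re ⟪·, ·⟫`, multiplication by `i` maps the orthogonal complement of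
`V` into `V'`. The claim is then the double orthogonal complement theorem. -/
theorem mem_topologicalClosure_of_forall [CompleteSpace H] {V : Submodule ℝ H} {x : H}
    (h : ∀ w ∈ sympCompl V, (⟪x, w⟫_ℂ).im = 0) : x ∈ V.topologicalClosure := by
  let _ : InnerProductSpace ℝ H := InnerProductSpace.complexToReal
  rw [← Submodule.orthogonal_orthogonal_eq_closure, Submodule.mem_orthogonal']
  intro w hw
  rw [Submodule.mem_orthogonal] at hw
  have hw' : Complex.I • w ∈ sympCompl V := fun v hv => by
    have : (⟪v, w⟫_ℂ).re = 0 := hw v hv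
    rw [inner_smul_right]
    simpa using this
  have := h _ hw'
  rw [inner_smul_right] at this
  change (⟪x, w⟫_ℂ).re = 0
  simpa using this

/-- Since `Re ⟪i v, w⟫ = Im ⟪v, w⟫`, the real orthogonal complement of `V + iV` is the complex
orthogonal complement of `V`. -/
theorem dense_sup_mulI_iff [CompleteSpace H] (V : Submodule ℝ H) :
    Dense ((V ⊔ mulI V : Submodule ℝ H) : Set H) ↔
      ∀ w : H, (∀ v ∈ V, ⟪v, w⟫_ℂ = 0) → w = 0 := by
  let _ : InnerProductSpace ℝ H := InnerProductSpace.complexToReal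
  rw [Submodule.dense_iff_topologicalClosure_eq_top, Submodule.topologicalClosure_eq_top_iff,
    Submodule.eq_bot_iff]
  refine forall_congr' fun w => imp_congr_left ?_
  rw [← Submodule.inf_orthogonal, Submodule.mem_inf, Submodule.mem_orthogonal,
    Submodule.mem_orthogonal]
  constructor
  · rintro ⟨h1, h2⟩ v hv
    have e1 : (⟪v, w⟫_ℂ).re = 0 := h1 v hv
    have e2 : (⟪Complex.I • v, w⟫_ℂ).re = 0 := h2 _ (mem_mulI.mpr ⟨v, hv, rfl⟩)
    rw [inner_smul_left] at e2
    refine Complex.ext e1 ?_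
    simpa using e2
  · intro h
    refine ⟨fun v hv => congrArg Complex.re (h v hv), fun u hu => ?_⟩
    obtain ⟨v, hv, rfl⟩ := mem_mulI.mp hu
    change (⟪Complex.I • v, w⟫_ℂ).re = 0
    rw [inner_smul_left, h v hv]
    simp

theorem dense_closure_sup_mulI_iff [CompleteSpace H] (V : Submodule ℝ H) :
    Dense ((V.topologicalClosure ⊔ mulI V.topologicalClosure : Submodule ℝ H) : Set H) ↔
      Dense ((V ⊔ mulI V : Submodule ℝ H) : Set H) := by
  rw [dense_sup_mulI_iff, dense_sup_mulI_iff]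
  refine forall_congr' fun w => imp_congr_left
    ⟨fun h v hv => h v (V.le_topologicalClosure hv), fun h v hv => ?_⟩
  have hcl : IsClosed {v : H | ⟪v, w⟫_ℂ = 0} := isClosed_eq (by fun_prop) (by fun_prop)
  exact closure_minimal h hcl hv

theorem smul_mem_of_mem_mulI {V : Submodule ℝ H} {w : H} (hw : w ∈ V) (hw' : w ∈ mulI V) (z : ℂ) :
    z • w ∈ V := by
  obtain ⟨u, hu, rfl⟩ := mem_mulI.mp hw'
  have : z • Complex.I • u = z.re • Complex.I • u - z.im • u := by
    conv_lhs => rw [← Complex.re_add_im z]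
    rw [add_smul, mul_smul, smul_smul Complex.I, Complex.I_mul_I, neg_one_smul, smul_neg,
      ← sub_eq_add_neg]
    rfl
  rw [this]
  exact V.sub_mem (V.smul_mem _ hw) (V.smul_mem _ hu)

/-- If `x` is complex orthogonal to `V'`, then so is `i x`, and both lie in `V'' = V̄`. Hence `x =
i(-i x)` lies in `V̄ ∩ iV̄`. -/
theorem dense_sympCompl [CompleteSpace H] {V : Submodule ℝ H}
    (h : V.topologicalClosure ⊓ mulI V.topologicalClosure = ⊥) :
    Dense ((sympCompl V ⊔ mulI (sympCompl V) : Submodule ℝ H) : Set H) := by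
  rw [dense_sup_mulI_iff]
  intro x hx
  have hx' : ∀ w ∈ sympCompl V, ⟪x, w⟫_ℂ = 0 := fun w hw => by
    rw [← inner_conj_symm, hx w hw, map_zero]
  have h1 : x ∈ V.topologicalClosure :=
    mem_topologicalClosure_of_forall fun w hw => by rw [hx' w hw]; rfl
  have h2 : -(Complex.I • x) ∈ V.topologicalClosure := neg_mem <|
    mem_topologicalClosure_of_forall fun w hw => by rw [inner_smul_left, hx' w hw]; simp
  rw [← Submodule.mem_bot ℝ, ← h]
  refine ⟨h1, mem_mulI.mpr ⟨_, h2, ?_⟩⟩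
  rw [smul_neg, smul_smul, Complex.I_mul_I, neg_one_smul, neg_neg]

/-! ### The vacuum -/

theorem inner_expVec_smul_eq_zero {V : Submodule ℝ H} {ξ : BosonicFock H} {c : ℂ}
    (h : ∀ v ∈ V, ⟪ξ, expVec (c • v)⟫_ℂ = 0) {x : H} (hx : x ∈ V ⊔ mulI V) :
    ⟪ξ, expVec (c • x)⟫_ℂ = 0 := by
  obtain ⟨v, hv, u, hu, rfl⟩ := Submodule.mem_sup.mp hx
  obtain ⟨w, hw, rfl⟩ := mem_mulI.mp hu
  rw [add_comm, smul_add, smul_comm]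
  -- For real `t` the vector `t w + v` lies in `V`; the required vector `v + i w` is its
  -- continuation to `t = i`.
  refine eq_zero_of_real (differentiable_inner_expVec_add_smul ξ (c • v) (c • w)) (fun t => ?_)
    Complex.I
  have := h _ (V.add_mem (V.smul_mem t hw) hv)
  rwa [RCLike.real_smul_eq_coe_smul (K := ℂ), smul_add, smul_comm] at this

theorem eq_zero_of_expVec_eq {w : H} (h : expVec w = vacuum H) : w = 0 := by
  have h1 := inner_expVec w w
  rw [h, inner_self_eq_norm_sq_to_K, norm_vacuum, inner_self_eq_norm_sq_to_K] at h1
  have h2 : (1 : ℝ) = Real.exp (‖w‖ ^ 2) := by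
    apply Complex.ofReal_injective
    push_cast
    simpa using h1
  have h3 := (Real.exp_eq_one_iff _).mp h2.symm
  simpa using h3

/-- The closed span of these exponential vectors is invariant under `W(V)`, so its projection lies
in `R(V)'`. That projection fixes `Ω`, hence fixes `T Ω` for every `T ∈ R(V)`. No approximation of
`T` by Weyl operators is required. -/
theorem orbit_vacuum_le (V : Submodule ℝ H) :
    orbit (weylAlgebra V) (vacuum H) ≤
      (Submodule.span ℂ ((fun v => expVec ((Complex.I / (√2 : ℝ) : ℂ) • v)) ''
        (V : Set H))).topologicalClosure := by
  set S := Submodule.span ℂ ((fun v => expVec ((Complex.I / (√2 : ℝ) : ℂ) • v)) '' (V : Set H))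
  set K := S.topologicalClosure
  have hS : ∀ v ∈ V, ∀ x ∈ S, weyl v x ∈ S := by
    intro v hv x hx
    induction hx using Submodule.span_induction with
    | mem x hx =>
      obtain ⟨w, hw, rfl⟩ := hx
      rw [weyl, shiftOp_expVec, ← smul_add]
      exact S.smul_mem _ (Submodule.subset_span ⟨_, V.add_mem hw hv, rfl⟩)
    | zero => rw [map_zero]; exact S.zero_mem
    | add x y _ _ hx hy => rw [map_add]; exact S.add_mem hx hy
    | smul c x _ hx => rw [map_smul]; exact S.smul_mem c hx
  have hK : ∀ v ∈ V, ∀ x ∈ K, weyl v x ∈ K := fun v hv x hx =>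
    map_mem_closure (weyl v).continuous hx (hS v hv)
  have : CompleteSpace K := S.isClosed_topologicalClosure.completeSpace_coe
  have hP : K.starProjection ∈ (weylAlgebra V).commutant :=
    mem_commutant_weylAlgebra.mpr fun v hv => (starProjection_mul_comm (hK v hv)
      (by rw [star_weyl]; exact hK _ (V.neg_mem hv))).symm
  have h0 : vacuum H ∈ K :=
    S.le_topologicalClosure (Submodule.subset_span ⟨0, V.zero_mem, by simp [vacuum]⟩)
  rintro _ ⟨T, hT, rfl⟩
  have hc : T (K.starProjection (vacuum H)) = K.starProjection (T (vacuum H)) :=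
    congrArg (fun A => A (vacuum H)) (VonNeumannAlgebra.mem_commutant_iff.mp hP T hT)
  rw [K.starProjection_eq_self_iff.mpr h0] at hc
  exact K.starProjection_eq_self_iff.mp hc.symm

theorem isCyclicVector_vacuum_iff [CompleteSpace H] (V : Submodule ℝ H) :
    IsCyclicVector (weylAlgebra V) (vacuum H) ↔
      Dense ((V ⊔ mulI V : Submodule ℝ H) : Set H) := by
  constructor
  · intro h
    rw [dense_sup_mulI_iff]
    intro w hw
    have hd := h.2
    rw [← coe_orbit] at hd
    refine eq_zero_of_expVec_eq (sub_eq_zero.mp (hd.eq_zero_of_inner_right ℂ fun x hx => ?_))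
    refine closure_minimal (t := {x | ⟪x, expVec w - vacuum H⟫_ℂ = 0}) ?_
      (isClosed_eq (by fun_prop) (by fun_prop)) (orbit_vacuum_le V hx)
    intro x hx
    change ⟪x, expVec w - vacuum H⟫_ℂ = 0
    induction hx using Submodule.span_induction with
    | mem x hx =>
      obtain ⟨v, hv, rfl⟩ := hx
      -- Both exponents vanish, the first because `w` is orthogonal to `V`, so the difference is `1
      -- - 1`.
      rw [inner_sub_right, inner_expVec, vacuum, inner_expVec, inner_smul_left, hw v hv]
      simp
    | zero => simp
    | add x y _ _ hx hy => rw [inner_add_left, hx, hy, add_zero]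
    | smul c x _ hx => rw [inner_smul_left, hx, mul_zero]
  · intro hd
    rw [isCyclicVector_iff norm_vacuum]
    intro ξ hξ
    have h0 : ∀ v ∈ V, ⟪ξ, expVec ((Complex.I / (√2 : ℝ) : ℂ) • v)⟫_ℂ = 0 := fun v hv => by
      rw [expVec_eq_shiftOp_vacuum, inner_smul_right, ← weyl, hξ _ (weyl_mem hv), mul_zero]
    have hv : ∀ x : H, ⟪ξ, expVec ((Complex.I / (√2 : ℝ) : ℂ) • x)⟫_ℂ = 0 := by
      have hcl : IsClosed {x : H | ⟪ξ, expVec ((Complex.I / (√2 : ℝ) : ℂ) • x)⟫_ℂ = 0} := by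
        have hc := continuous_expVec (H := H)
        exact isClosed_eq (by fun_prop) (by fun_prop)
      exact fun x => closure_minimal (fun y hy => inner_expVec_smul_eq_zero h0 hy) hcl (hd x)
    refine dense_expVec.eq_zero_of_inner_left ℂ fun x hx => ?_
    induction hx using Submodule.span_induction with
    | mem x hx =>
      obtain ⟨w, rfl⟩ := hx
      have := hv ((Complex.I / (√2 : ℝ) : ℂ)⁻¹ • w)
      rwa [smul_inv_smul₀ I_div_sqrt_two_ne_zero] at this
    | zero => simp
    | add x y _ _ hx hy => rw [inner_add_right, hx, hy, add_zero]
    | smul c x _ hx => rw [inner_smul_right, hx, mul_zero]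

theorem isSeparatingVector_vacuum_iff [CompleteSpace H] (V : Submodule ℝ H) :
    IsSeparatingVector (weylAlgebra V) (vacuum H) ↔
      V.topologicalClosure ⊓ mulI V.topologicalClosure = ⊥ := by
  constructor
  · intro h
    -- The complex line through `w` lies in the closure of `V` only, so the commutant has to be that
    -- of `R(V̄)`.
    rw [weylAlgebra_topologicalClosure] at h
    have hd := (isCyclicVector_commutant h).2
    rw [Submodule.eq_bot_iff]
    rintro w ⟨hw, hw'⟩
    refine eq_zero_of_expVec_eq (sub_eq_zero.mp (hd.eq_zero_of_inner_left ℂ ?_))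
    rintro _ ⟨T, hT, rfl⟩
    rw [mem_commutant_weylAlgebra] at hT
    rw [inner_sub_left, sub_eq_zero]
    exact inner_expVec_apply_vacuum (commute_shiftOp_of_commute_weyl fun z =>
      hT _ (smul_mem_of_mem_mulI hw hw' z))
  · intro h
    exact isSeparatingVector_of_isCyclicVector
      ((weylAlgebra_le_commutant_iff _ _).mpr le_rfl)
      ((isCyclicVector_vacuum_iff _).mpr (dense_sympCompl h))

theorem vacuum_mem_cyclicSeparating_iff [CompleteSpace H] (V : Submodule ℝ H) :
    vacuum H ∈ cyclicSeparating (weylAlgebra V) ↔ IsStandard V.topologicalClosure := by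
  rw [cyclicSeparating, Set.mem_ofPred_eq, isCyclicVector_vacuum_iff,
    isSeparatingVector_vacuum_iff, IsStandard, dense_closure_sup_mulI_iff, and_comm,
    and_iff_right V.isClosed_topologicalClosure]

end BoseFock

theorem lemma6p2 {H : Type*} [NormedAddCommGroup H] [InnerProductSpace ℂ H] [CompleteSpace H] :
    -- (i) `R(H) = B(F₊(H))`, and the Heisenberg group acts irreducibly
    ((BoseFock.weylAlgebra (⊤ : Submodule ℝ H) :
        Set (BoseFock.BosonicFock H →L[ℂ] BoseFock.BosonicFock H)) = Set.univ ∧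
      BoseFock.IsIrreducibleRep (BoseFock.heisRep H)) ∧
    -- (ii) locality
    (∀ V W : Submodule ℝ H,
      BoseFock.weylAlgebra V ≤ (BoseFock.weylAlgebra W).commutant ↔ V ≤ BoseFock.sympCompl W) ∧
    -- (iii) passage to the closure
    (∀ V : Submodule ℝ H,
      BoseFock.weylAlgebra V = BoseFock.weylAlgebra V.topologicalClosure) ∧
    -- (iv) the vacuum is cyclic
    (∀ V : Submodule ℝ H,
      BoseFock.IsCyclicVector (BoseFock.weylAlgebra V) (BoseFock.vacuum H) ↔
        Dense ((V ⊔ BoseFock.mulI V : Submodule ℝ H) : Set H)) ∧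
    -- (v) the vacuum is separating
    (∀ V : Submodule ℝ H,
      BoseFock.IsSeparatingVector (BoseFock.weylAlgebra V) (BoseFock.vacuum H) ↔
        V.topologicalClosure ⊓ BoseFock.mulI V.topologicalClosure = ⊥) ∧
    -- (vi) the vacuum is cyclic and separating
    (∀ V : Submodule ℝ H,
      BoseFock.vacuum H ∈ BoseFock.cyclicSeparating (BoseFock.weylAlgebra V) ↔
        BoseFock.IsStandard V.topologicalClosure) := by
  exact ⟨⟨BoseFock.coe_weylAlgebra_top, BoseFock.isIrreducibleRep_heisRep⟩,
    BoseFock.weylAlgebra_le_commutant_iff, BoseFock.weylAlgebra_topologicalClosure,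
    BoseFock.isCyclicVector_vacuum_iff, BoseFock.isSeparatingVector_vacuum_iff,
    BoseFock.vacuum_mem_cyclicSeparating_iff⟩
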